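/- Let $B$ be a Boolean algebra and let $\mathrm{Ult}(B)$ be the set of ultrafilters on $B$ with the Stone topology, whose basic open sets are $\{p : a\in p\}$ for $a\in B$. For an infinite cardinal $\kappa$, say that $B$ is *$\kappa$-Corson* if there is a set $G\subseteq B$ generating $B$ as a Boolean algebra such that $|G\cap p|<\kappa$ for every $p\in\mathrm{Ult}(B)$, and that $B$ is *$\kappa$-Valdivia* if there are a set $G\subseteq B$ generating $B$ and a topologically dense set $D\subseteq\mathrm{Ult}(B)$ such that $|G\cap p|<\kappa$ for every $p\in D$. Say that $B$ has the *countable separation property* if for all countable $S,T\subseteq B$ with $a\wedge b=0$ for all $a\in S$, $b\in T$, there is $c\in B$ with $a\le c$ for all $a\in S$ and $b\le \neg c$ for all $b\in T$. **Theorem.** Let $B$ be an infinite Boolean algebra with the countable separation property and let $\kappa$ be an uncountable regular cardinal. If $B$ is $\kappa$-Valdivia, then $B$ is $\kappa$-Corson. -/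

import Mathlib

universe u

/-- An ultrafilter on a Boolean algebra: a proper filter that contains `a` or `aᶜ` for each `a`. -/
structure BAUlt (B : Type u) [BooleanAlgebra B] where
  /-- The underlying (order-theoretic) filter. -/
  toPFilter : Order.PFilter B
  bot_notMem : ⊥ ∉ toPFilter
  mem_or_compl_mem : ∀ a : B, a ∈ toPFilter ∨ aᶜ ∈ toPFilter

namespace BAUlt

variable {B : Type u} [BooleanAlgebra B]

/-- The set of elements of an ultrafilter. -/
def carrier (p : BAUlt B) : Set B := {a | a ∈ p.toPFilter}

/-- The basic clopen set of all ultrafilters containing `a`. -/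
def basicClopen (a : B) : Set (BAUlt B) := {p | a ∈ p.carrier}

/-- The Stone topology on the set of ultrafilters. -/
instance : TopologicalSpace (BAUlt B) :=
  TopologicalSpace.generateFrom (Set.range (basicClopen (B := B)))

end BAUlt

/-- `G` generates `B`: the least Boolean subalgebra of `B` containing `G` is `B` itself. -/
def BAGenerates {B : Type u} [BooleanAlgebra B] (G : Set B) : Prop :=
  BooleanSubalgebra.closure G = ⊤

/-- `B` is `κ`-Corson: some generating set meets every ultrafilter in fewer than `κ` elements. -/
def IsKappaCorson (B : Type u) [BooleanAlgebra B] (κ : Cardinal.{u}) : Prop :=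
  ∃ G : Set B, BAGenerates G ∧ ∀ p : BAUlt B, Cardinal.mk ↥(G ∩ p.carrier) < κ

/-- `B` is `κ`-Valdivia: some generating set meets every ultrafilter from some topologically dense
set of ultrafilters in fewer than `κ` elements. -/
def IsKappaValdivia (B : Type u) [BooleanAlgebra B] (κ : Cardinal.{u}) : Prop :=
  ∃ (G : Set B) (D : Set (BAUlt B)), BAGenerates G ∧ Dense D ∧
    ∀ p ∈ D, Cardinal.mk ↥(G ∩ p.carrier) < κ

/-- The `μ`-separation property of a Boolean algebra. -/
def HasSeparationProperty (B : Type u) [BooleanAlgebra B] (μ : Cardinal.{u}) : Prop :=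
  ∀ S T : Set B, Cardinal.mk ↥S < μ → Cardinal.mk ↥T < μ →
    (∀ a ∈ S, ∀ b ∈ T, a ⊓ b = ⊥) →
    ∃ c : B, (∀ a ∈ S, a ≤ c) ∧ (∀ b ∈ T, b ≤ cᶜ)

/-- The countable separation property is the `ℵ₁`-separation property. -/
def HasCountableSeparationProperty (B : Type u) [BooleanAlgebra B] : Prop :=
  HasSeparationProperty B (Cardinal.aleph 1)

open Cardinal

/-! ### Ultrafilters and agreement on a set of ultrafilters -/

namespace BAUlt

variable {B : Type u} [BooleanAlgebra B]

/-! A Valdivia witness `G` already satisfies `#G < κ`, so it is itself a Corson witness. If `κ ≤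
#G`, closing off gives small sets `H n`, each generating more than the last, with every nonzero
element generated by `H n` in an ultrafilter whose trace on `G` lies in `H (n + 1)`. Let `K` be the
ultrafilters with trace inside `⋃ n, H n`. Elements agreeing on `K` with something generated by `H
n` form an increasing chain of subalgebras, which exhausts `B` since generators outside the union
vanish on `K`. The chain is proper because `K` detects differences inside the union. This
contradicts `exists_eq_top`, where countable separation enters. -/

theorem mem_of_le (p : BAUlt B) {a b : B} (h : a ≤ b) (ha : a ∈ p.carrier) : b ∈ p.carrier :=
  Order.PFilter.mem_of_le h ha

theorem sup_mem_iff (p : BAUlt B) {a b : B} :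
    a ⊔ b ∈ p.carrier ↔ a ∈ p.carrier ∨ b ∈ p.carrier := by
  refine ⟨fun h => ?_, fun h => h.elim (p.mem_of_le le_sup_left) (p.mem_of_le le_sup_right)⟩
  by_contra! hab
  have ha : aᶜ ∈ p.toPFilter := (p.mem_or_compl_mem a).resolve_left hab.1
  have hb : bᶜ ∈ p.toPFilter := (p.mem_or_compl_mem b).resolve_left hab.2
  have := Order.PFilter.inf_mem h (Order.PFilter.inf_mem ha hb)
  rw [← compl_sup, inf_compl_self] at this
  exact p.bot_notMem this

/-- Every nonzero element of a Boolean algebra lies in an ultrafilter. -/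
theorem exists_mem_carrier {b : B} (hb : b ≠ ⊥) : ∃ p : BAUlt B, b ∈ p.carrier := by
  have hdis : Disjoint (Order.PFilter.principal b : Set B)
      (Order.Ideal.principal (⊥ : B) : Set B) := by
    rw [Set.disjoint_left]
    intro x hx hx'
    have h₁ : b ≤ x := hx
    have h₂ : x ≤ ⊥ := hx'
    exact hb (le_bot_iff.1 (h₁.trans h₂))
  obtain ⟨J, hJ, -, hd⟩ := DistribLattice.prime_ideal_of_disjoint_filter_ideal hdis
  have key : ∀ x, x ∈ hJ.toPrimePair.F ↔ x ∉ J := fun x => by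
    have := hJ.toPrimePair.compl_I_eq_F
    rw [← SetLike.mem_coe, ← this]
    rfl
  refine ⟨⟨hJ.toPrimePair.F, ?_, fun a => ?_⟩, ?_⟩
  · rw [key]
    exact fun h => h J.bot_mem
  · rw [key, key]
    by_contra! h
    have := J.sup_mem h.1 h.2
    rw [sup_compl_eq_top] at this
    exact Set.disjoint_left.1 hd (show b ≤ ⊤ from le_top) this
  · exact (key b).2 (Set.disjoint_left.1 hd (show b ≤ b from le_rfl))

theorem exists_mem_of_dense {D : Set (BAUlt B)} (hD : Dense D) {b : B} (hb : b ≠ ⊥) :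
    ∃ p ∈ D, b ∈ p.carrier := by
  have ho : IsOpen (basicClopen b) := TopologicalSpace.isOpen_generateFrom_of_mem ⟨b, rfl⟩
  obtain ⟨p, hp, hpD⟩ := hD.inter_open_nonempty _ ho (exists_mem_carrier hb)
  exact ⟨p, hpD, hp⟩

/-- The elements that agree on all ultrafilters of `K` with an element of `A`. -/
def saturation (K : Set (BAUlt B)) (A : BooleanSubalgebra B) : BooleanSubalgebra B where
  carrier := {b | ∃ c ∈ A, ∀ p ∈ K, symmDiff b c ∉ p.carrier}
  supClosed' := by
    rintro a ⟨c, hc, hac⟩ b ⟨d, hd, hbd⟩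
    refine ⟨c ⊔ d, BooleanSubalgebra.sup_mem hc hd, fun p hp h => ?_⟩
    have hle : symmDiff (a ⊔ b) (c ⊔ d) ≤ symmDiff a c ⊔ symmDiff b d := by
      simp only [symmDiff, sup_sdiff]
      refine sup_le (sup_le ?_ ?_) (sup_le ?_ ?_)
      · exact (sdiff_le_sdiff_left le_sup_left).trans (le_sup_left.trans le_sup_left)
      · exact (sdiff_le_sdiff_left le_sup_right).trans (le_sup_left.trans le_sup_right)
      · exact (sdiff_le_sdiff_left le_sup_left).trans (le_sup_right.trans le_sup_left)
      · exact (sdiff_le_sdiff_left le_sup_right).trans (le_sup_right.trans le_sup_right)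
    exact (p.sup_mem_iff.1 (p.mem_of_le hle h)).elim (hac p hp) (hbd p hp)
  infClosed' := by
    rintro a ⟨c, hc, hac⟩ b ⟨d, hd, hbd⟩
    refine ⟨c ⊓ d, BooleanSubalgebra.inf_mem hc hd, fun p hp h => ?_⟩
    have hle : symmDiff (a ⊓ b) (c ⊓ d) ≤ symmDiff a c ⊔ symmDiff b d := by
      simp only [symmDiff, sdiff_inf]
      refine sup_le (sup_le ?_ ?_) (sup_le ?_ ?_)
      · exact (sdiff_le_sdiff_right inf_le_left).trans (le_sup_left.trans le_sup_left)
      · exact (sdiff_le_sdiff_right inf_le_right).trans (le_sup_left.trans le_sup_right)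
      · exact (sdiff_le_sdiff_right inf_le_left).trans (le_sup_right.trans le_sup_left)
      · exact (sdiff_le_sdiff_right inf_le_right).trans (le_sup_right.trans le_sup_right)
    exact (p.sup_mem_iff.1 (p.mem_of_le hle h)).elim (hac p hp) (hbd p hp)
  compl_mem' := by
    rintro a ⟨c, hc, hac⟩
    refine ⟨cᶜ, BooleanSubalgebra.compl_mem hc, fun p hp h => hac p hp ?_⟩
    rwa [compl_symmDiff_compl] at h
  bot_mem' := ⟨⊥, BooleanSubalgebra.bot_mem, fun p _ h => p.bot_notMem (by
    rwa [symmDiff_self] at h)⟩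

theorem mem_saturation {K : Set (BAUlt B)} {A : BooleanSubalgebra B} {b : B} :
    b ∈ saturation K A ↔ ∃ c ∈ A, ∀ p ∈ K, symmDiff b c ∉ p.carrier := Iff.rfl

theorem saturation_mono (K : Set (BAUlt B)) : Monotone (saturation K) :=
  fun _ _ h _ ⟨c, hc, hbc⟩ => ⟨c, h hc, hbc⟩

theorem le_saturation (K : Set (BAUlt B)) (A : BooleanSubalgebra B) : A ≤ saturation K A :=
  fun b hb => ⟨b, hb, fun p _ h => p.bot_notMem (by rwa [symmDiff_self] at h)⟩

end BAUlt

/-! ### Countable chains of subalgebras -/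

section Chains

variable {B : Type u} [BooleanAlgebra B]

theorem HasCountableSeparationProperty.exists_separator (hB : HasCountableSeparationProperty B)
    {a b : ℕ → B} (hab : ∀ i j, Disjoint (a i) (b j)) :
    ∃ c, ∀ i, a i ≤ c ∧ Disjoint (b i) c := by
  have hc : ∀ f : ℕ → B, #(Set.range f) < ℵ_ 1 := fun f =>
    (le_aleph0_iff_set_countable.2 (Set.countable_range f)).trans_lt aleph0_lt_aleph_one
  obtain ⟨c, h₁, h₂⟩ := hB (Set.range a) (Set.range b) (hc a) (hc b) (by
    rintro _ ⟨i, rfl⟩ _ ⟨j, rfl⟩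
    exact (hab i j).eq_bot)
  exact ⟨c, fun i => ⟨h₁ _ ⟨i, rfl⟩, le_compl_iff_disjoint_right.1 (h₂ _ ⟨i, rfl⟩)⟩⟩

/-- No term of the sequence `A` contains all elements below `e`. -/
def UnboundedBelow (A : ℕ → BooleanSubalgebra B) (e : B) : Prop :=
  ∀ n, ∃ a ≤ e, a ∉ A n

variable {A : ℕ → BooleanSubalgebra B}

theorem not_unboundedBelow {e : B} : ¬ UnboundedBelow A e ↔ ∃ n, ∀ a ≤ e, a ∈ A n := by
  simp [UnboundedBelow]

theorem not_unboundedBelow_sup (hA : Monotone A) {e f : B} (he : ¬ UnboundedBelow A e)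
    (hf : ¬ UnboundedBelow A f) : ¬ UnboundedBelow A (e ⊔ f) := by
  rw [not_unboundedBelow] at *
  obtain ⟨m, hm⟩ := he
  obtain ⟨n, hn⟩ := hf
  refine ⟨max m n, fun a ha => ?_⟩
  rw [← inf_eq_left.2 ha, inf_sup_left]
  exact BooleanSubalgebra.sup_mem (hA (le_max_left m n) (hm _ inf_le_right))
    (hA (le_max_right m n) (hn _ inf_le_right))

/-- A `c` separating all `a n` from all `e n \ a n` recovers `a n = c ⊓ e n`. Taking `a n` outside a
late term that contains `e n` keeps `c` out of every `A n`. -/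
theorem not_pairwise_disjoint_unboundedBelow (hB : HasCountableSeparationProperty B)
    (hA : Monotone A) (hU : ∀ b, ∃ n, b ∈ A n) {e : ℕ → B}
    (he : ∀ n, UnboundedBelow A (e n)) (hd : Pairwise fun i j => Disjoint (e i) (e j)) :
    False := by
  have hex : ∀ n, ∃ m, n ≤ m ∧ e n ∈ A m ∧ ∃ a ≤ e n, a ∉ A m := fun n => by
    obtain ⟨k, hk⟩ := hU (e n)
    exact ⟨max n k, le_max_left _ _, hA (le_max_right _ _) hk, he n _⟩
  choose m hnm hem a hae ham using hex
  obtain ⟨c, hc⟩ := hB.exists_separator (a := a) (b := fun n => e n \ a n) fun i j => by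
    rcases eq_or_ne i j with rfl | hij
    · exact disjoint_sdiff_self_right
    · exact (hd hij).mono (hae i) sdiff_le
  obtain ⟨n, hn⟩ := hU c
  refine ham n ?_
  have : a n = c ⊓ e n := by
    refine le_antisymm (le_inf (hc n).1 (hae n)) ?_
    have h := (hc n).2.symm
    rw [disjoint_iff, ← inf_sdiff_assoc] at h
    exact sdiff_eq_bot_iff.1 h
  rw [this]
  exact BooleanSubalgebra.inf_mem (hA (hnm n) hn) (hem n)

theorem exists_disjoint_unboundedBelow
    (hsplit : ∀ e, UnboundedBelow A e → ∃ f ≤ e, UnboundedBelow A f ∧ UnboundedBelow A (e \ f))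
    {e₀ : B} (he₀ : UnboundedBelow A e₀) :
    ∃ e : ℕ → B, (∀ n, UnboundedBelow A (e n)) ∧ Pairwise fun i j => Disjoint (e i) (e j) := by
  choose! φ hφle hφ hφ' using hsplit
  let f : ℕ → B := fun n => (fun e => e \ φ e)^[n] e₀
  have hsucc : ∀ n, f (n + 1) = f n \ φ (f n) := fun n => Function.iterate_succ_apply' _ _ _
  have hf : ∀ n, UnboundedBelow A (f n) := fun n => by
    induction n with
    | zero => exact he₀
    | succ n ih => rw [hsucc]; exact hφ' _ ih
  have hanti : Antitone f := antitone_nat_of_succ_le fun n => by rw [hsucc]; exact sdiff_le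
  refine ⟨fun n => φ (f n), fun n => hφ _ (hf n), ?_⟩
  have hlt : ∀ i j, i < j → Disjoint (φ (f i)) (φ (f j)) := fun i j hij => by
    have h : φ (f j) ≤ f i \ φ (f i) :=
      ((hφle _ (hf j)).trans (hanti hij)).trans (hsucc i).le
    exact disjoint_sdiff_self_right.mono_right h
  intro i j hij
  rcases hij.lt_or_gt with h | h
  · exact hlt i j h
  · exact (hlt j i h).symm

/-- Bounded elements form an ideal, so the join `s` of the earlier terms stays bounded. For large
indices `a ⊓ s` is in the subalgebra, so removing `s` from `a` leaves it outside. -/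
theorem exists_disjoint_notMem (hA : Monotone A) {e : B}
    (he : ∀ n, ∃ a ≤ e, a ∉ A n ∧ ¬ UnboundedBelow A a) :
    ∃ a : ℕ → B, (∀ n, a n ≤ e ∧ a n ∉ A n) ∧ Pairwise fun i j => Disjoint (a i) (a j) := by
  have hstep : ∀ (n : ℕ) (s : B), ¬ UnboundedBelow A s →
      ∃ a, a ≤ e ∧ Disjoint s a ∧ a ∉ A n ∧ ¬ UnboundedBelow A (s ⊔ a) := fun n s hs => by
    obtain ⟨k, hk⟩ := not_unboundedBelow.1 hs
    obtain ⟨a, hae, han, hab⟩ := he (max n k)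
    refine ⟨a \ s, sdiff_le.trans hae, disjoint_sdiff_self_right, fun h => han ?_, ?_⟩
    · rw [← sup_inf_sdiff a s]
      exact BooleanSubalgebra.sup_mem (hA (le_max_right n k) (hk _ inf_le_right))
        (hA (le_max_left n k) h)
    · rw [sup_sdiff_self_right]
      exact not_unboundedBelow_sup hA hs hab
  choose! φ hφe hφd hφn hφb using hstep
  let s : ℕ → B := fun n => Nat.rec ⊥ (fun n s => s ⊔ φ n s) n
  have hsucc : ∀ n, s (n + 1) = s n ⊔ φ n (s n) := fun n => rfl
  have hs : ∀ n, ¬ UnboundedBelow A (s n) := fun n => by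
    induction n with
    | zero =>
      refine not_unboundedBelow.2 ⟨0, fun a ha => ?_⟩
      rw [le_bot_iff.1 (show a ≤ ⊥ from ha)]
      exact BooleanSubalgebra.bot_mem
    | succ n ih => exact hφb n _ ih
  have hmono : Monotone s := monotone_nat_of_le_succ fun n => le_sup_left
  have hlt : ∀ i j, i < j → Disjoint (φ i (s i)) (φ j (s j)) := fun i j hij =>
    (hφd j _ (hs j)).mono_left (le_sup_right.trans (hmono hij))
  refine ⟨fun n => φ n (s n), fun n => ⟨hφe n _ (hs n), hφn n _ (hs n)⟩, fun i j hij => ?_⟩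
  rcases hij.lt_or_gt with h | h
  · exact hlt i j h
  · exact (hlt j i h).symm

/-- A Boolean algebra with the countable separation property is not the union of a countable
increasing chain of proper subalgebras. -/
theorem HasCountableSeparationProperty.exists_eq_top (hB : HasCountableSeparationProperty B)
    (hA : Monotone A) (hU : ∀ b, ∃ n, b ∈ A n) : ∃ n, A n = ⊤ := by
  by_contra! hne
  have htop : UnboundedBelow A ⊤ := fun n => by
    by_contra! h
    exact hne n (eq_top_iff.2 fun a _ => h a le_top)
  by_cases hsplit : ∀ e, UnboundedBelow A e →
      ∃ f ≤ e, UnboundedBelow A f ∧ UnboundedBelow A (e \ f)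
  · obtain ⟨e, he, hd⟩ := exists_disjoint_unboundedBelow hsplit htop
    exact not_pairwise_disjoint_unboundedBelow hB hA hU he hd
  push Not at hsplit
  obtain ⟨e, he, hprime⟩ := hsplit
  obtain ⟨a, ha, hd⟩ := exists_disjoint_notMem (A := A) (e := e) hA fun n => by
    obtain ⟨k, hk⟩ := hU e
    obtain ⟨a, hae, han⟩ := he (max n k)
    have hn : a ∉ A n := fun h => han (hA (le_max_left _ _) h)
    by_cases hb : UnboundedBelow A a
    · refine ⟨e \ a, sdiff_le, fun h => han ?_, hprime a hae hb⟩
      rw [← sdiff_sdiff_eq_self hae]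
      exact BooleanSubalgebra.sdiff_mem (hA (le_max_right _ _) hk) (hA (le_max_left _ _) h)
    · exact ⟨a, hae, hn, hb⟩
  obtain ⟨c, hc⟩ := hB.exists_separator (a := fun n => a (2 * n)) (b := fun n => a (2 * n + 1))
    fun i j => hd (by omega)
  -- As `e` does not split, `e ⊓ c` or `e \ c` is bounded; the former lies above all even terms, the
  -- latter above all odd ones.
  by_cases hb : UnboundedBelow A (e ⊓ c)
  · have := hprime _ inf_le_left hb
    obtain ⟨n, hn⟩ := not_unboundedBelow.1 this
    rw [sdiff_inf_self_left] at hn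
    exact (ha (2 * n + 1)).2 (hA (by omega)
      (hn _ (le_sdiff.2 ⟨(ha _).1, (hc n).2⟩)))
  · obtain ⟨n, hn⟩ := not_unboundedBelow.1 hb
    exact (ha (2 * n)).2 (hA (by omega) (hn _ (le_inf (ha _).1 (hc n).1)))

end Chains

/-! ### Cardinal bounds below `κ` -/

section Cardinality

variable {B : Type u} {κ : Cardinal.{u}}

theorem Cardinal.IsRegular.mk_iUnion_nat_lt (hκ : κ.IsRegular) (hκ' : ℵ₀ < κ) {s : ℕ → Set B}
    (hs : ∀ n, #(s n) < κ) : #(⋃ n, s n : Set B) < κ := by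
  have h : (⋃ n, s n) = ⋃ n : ULift.{u} ℕ, s n.down := by
    ext x
    simp [ULift.exists]
  rw [h, card_iUnion_lt_iff_forall_of_isRegular hκ (by simpa using hκ')]
  exact fun n => hs _

variable [BooleanAlgebra B]

theorem BooleanSubalgebra.mk_closure_lt (hκ : κ.IsRegular) (hκ' : ℵ₀ < κ) {s : Set B}
    (hs : #s < κ) : #(closure s) < κ := by
  let step : Set B → Set B := fun t => insert ⊥ t ∪ (compl '' t ∪ Set.image2 (· ⊔ ·) t t)
  let t : ℕ → Set B := fun n => step^[n] s
  have hsucc : ∀ n, t (n + 1) = step (t n) := fun n => Function.iterate_succ_apply' _ _ _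
  have hcard : ∀ n, #(t n) < κ := fun n => by
    induction n with
    | zero => exact hs
    | succ n ih =>
      rw [hsucc]
      refine (mk_union_le _ _).trans_lt (add_lt_of_lt hκ.aleph0_le ?_
        ((mk_union_le _ _).trans_lt (add_lt_of_lt hκ.aleph0_le (mk_image_le.trans_lt ih) ?_)))
      · exact mk_insert_le.trans_lt
          (add_lt_of_lt hκ.aleph0_le ih (one_lt_aleph0.trans hκ'))
      · exact (mk_image2_le).trans_lt (mul_lt_of_lt hκ.aleph0_le ih ih)
  have hmono : Monotone t := monotone_nat_of_le_succ fun n => by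
    rw [hsucc]
    exact (Set.subset_insert _ _).trans Set.subset_union_left
  have hsup : ∀ a ∈ ⋃ n, t n, ∀ b ∈ ⋃ n, t n, a ⊔ b ∈ ⋃ n, t n := fun a ha b hb => by
    obtain ⟨m, hm⟩ := Set.mem_iUnion.1 ha
    obtain ⟨n, hn⟩ := Set.mem_iUnion.1 hb
    refine Set.mem_iUnion.2 ⟨max m n + 1, ?_⟩
    rw [hsucc]
    exact Or.inr (Or.inr ⟨a, hmono (le_max_left m n) hm, b, hmono (le_max_right m n) hn, rfl⟩)
  have hcompl : ∀ a ∈ ⋃ n, t n, aᶜ ∈ ⋃ n, t n := fun a ha => by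
    obtain ⟨m, hm⟩ := Set.mem_iUnion.1 ha
    refine Set.mem_iUnion.2 ⟨m + 1, ?_⟩
    rw [hsucc]
    exact Or.inr (Or.inl ⟨a, hm, rfl⟩)
  have hsub : (closure s : Set B) ⊆ ⋃ n, t n := fun x hx => by
    induction hx using closure_bot_sup_induction with
    | mem x hx => exact Set.mem_iUnion.2 ⟨0, hx⟩
    | bot => exact Set.mem_iUnion.2 ⟨1, Or.inl (Set.mem_insert _ _)⟩
    | sup x hx y hy ihx ihy => exact hsup x ihx y ihy
    | compl x hx ih => exact hcompl x ih
  exact (mk_le_mk_of_subset hsub).trans_lt (hκ.mk_iUnion_nat_lt hκ' hcard)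

end Cardinality

/-! ### Bounding the generating set -/

section Valdivia

variable {B : Type u} [BooleanAlgebra B] {κ : Cardinal.{u}}

/-- A small part of a large generating set witnessing the Valdivia property can be enlarged to a
small part that generates more and that contains the trace on `G` of an ultrafilter through each
nonzero element generated by the given part. -/
theorem exists_enlargement (hκ : κ.IsRegular) (hκ' : ℵ₀ < κ) {G : Set B} {D : Set (BAUlt B)}
    (hD : Dense D) (hGD : ∀ p ∈ D, #(G ∩ p.carrier : Set B) < κ) (hG : κ ≤ #G) {H : Set B}
    (hH : #H < κ) :
    ∃ H' : Set B, #H' < κ ∧ H ⊆ H' ∧ (∃ g ∈ H', g ∉ BooleanSubalgebra.closure H) ∧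
      ∀ b ∈ BooleanSubalgebra.closure H, b ≠ ⊥ →
        ∃ p : BAUlt B, b ∈ p.carrier ∧ G ∩ p.carrier ⊆ H' := by
  have hcl := BooleanSubalgebra.mk_closure_lt hκ hκ' hH
  obtain ⟨g, -, hg⟩ : ∃ g ∈ G, g ∉ BooleanSubalgebra.closure H := by
    by_contra! h
    exact (hG.trans (mk_le_mk_of_subset h)).not_gt hcl
  have hp : ∀ b : BooleanSubalgebra.closure H, ∃ p ∈ D, (b : B) ≠ ⊥ → (b : B) ∈ p.carrier := by
    intro b
    by_cases hb : (b : B) = ⊥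
    -- Any member of `D` serves for `⊥`; `D` is nonempty because `g ≠ ⊥`.
    · obtain ⟨p, hp, -⟩ := BAUlt.exists_mem_of_dense hD (b := g) fun h => hg (by
        rw [h]; exact BooleanSubalgebra.bot_mem)
      exact ⟨p, hp, fun h => (h hb).elim⟩
    · obtain ⟨p, hp, hbp⟩ := BAUlt.exists_mem_of_dense hD hb
      exact ⟨p, hp, fun _ => hbp⟩
  choose p hpD hp using hp
  refine ⟨insert g H ∪ ⋃ b, G ∩ (p b).carrier, ?_, ?_, ⟨g, Or.inl (Set.mem_insert _ _), hg⟩, ?_⟩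
  · refine (mk_union_le _ _).trans_lt (add_lt_of_lt hκ.aleph0_le ?_ ?_)
    · exact mk_insert_le.trans_lt (add_lt_of_lt hκ.aleph0_le hH (one_lt_aleph0.trans hκ'))
    · exact (card_iUnion_lt_iff_forall_of_isRegular hκ hcl).2 fun b => hGD _ (hpD b)
  · exact (Set.subset_insert _ _).trans Set.subset_union_left
  · intro b hb hb0
    exact ⟨p ⟨b, hb⟩, hp ⟨b, hb⟩ hb0, (Set.subset_iUnion (fun b => G ∩ (p b).carrier)
      ⟨b, hb⟩).trans Set.subset_union_right⟩

/-- In a Boolean algebra with the countable separation property, a generating set that witnesses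
the `κ`-Valdivia property has fewer than `κ` elements. -/
theorem HasCountableSeparationProperty.mk_lt_of_dense (hB : HasCountableSeparationProperty B)
    (hκ : κ.IsRegular) (hκ' : ℵ₀ < κ) {G : Set B} {D : Set (BAUlt B)} (hgen : BAGenerates G)
    (hD : Dense D) (hGD : ∀ p ∈ D, #(G ∩ p.carrier : Set B) < κ) : #G < κ := by
  by_contra! hG
  choose! φ hφκ hφle hφg hφp using
    fun (H : Set B) (hH : #H < κ) => exists_enlargement hκ hκ' hD hGD hG hH
  let H : ℕ → Set B := fun n => φ^[n] ∅
  have hsucc : ∀ n, H (n + 1) = φ (H n) := fun n => Function.iterate_succ_apply' _ _ _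
  have hκH : ∀ n, #(H n) < κ := fun n => by
    induction n with
    | zero => simpa [H] using hκ.pos
    | succ n ih => rw [hsucc]; exact hφκ _ ih
  have hmono : Monotone H := monotone_nat_of_le_succ fun n => by
    rw [hsucc]; exact hφle _ (hκH n)
  let K : Set (BAUlt B) := {p | G ∩ p.carrier ⊆ ⋃ n, H n}
  let A : ℕ → BooleanSubalgebra B := fun n =>
    BAUlt.saturation K (BooleanSubalgebra.closure (H n))
  have hA : Monotone A := fun m n h =>
    BAUlt.saturation_mono K (BooleanSubalgebra.closure_mono (hmono h))
  have hU : ∀ b, ∃ n, b ∈ A n := fun b => by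
    have hb : b ∈ BooleanSubalgebra.closure G := by
      rw [show BooleanSubalgebra.closure G = ⊤ from hgen]
      exact BooleanSubalgebra.mem_top
    induction hb using BooleanSubalgebra.closure_bot_sup_induction with
    | mem x hx =>
      by_cases hxH : x ∈ ⋃ n, H n
      · obtain ⟨n, hn⟩ := Set.mem_iUnion.1 hxH
        exact ⟨n, BAUlt.le_saturation _ _ (BooleanSubalgebra.subset_closure hn)⟩
      -- No ultrafilter in `K` contains `x`, so `x` agrees with `⊥` there.
      · refine ⟨0, ⊥, BooleanSubalgebra.bot_mem, fun p hp h => hxH (hp ⟨hx, ?_⟩)⟩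
        rwa [symmDiff_bot] at h
    | bot => exact ⟨0, BooleanSubalgebra.bot_mem⟩
    | sup x hx y hy ihx ihy =>
      obtain ⟨m, hm⟩ := ihx
      obtain ⟨n, hn⟩ := ihy
      exact ⟨max m n, BooleanSubalgebra.sup_mem (hA (le_max_left m n) hm)
        (hA (le_max_right m n) hn)⟩
    | compl x hx ih => exact ih.imp fun n => BooleanSubalgebra.compl_mem
  obtain ⟨n, hn⟩ := hB.exists_eq_top hA hU
  obtain ⟨g, hgH, hg⟩ := hφg (H n) (hκH n)
  rw [← hsucc] at hgH
  have hgA : g ∈ A n := hn ▸ BooleanSubalgebra.mem_top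
  obtain ⟨c, hc, hgc⟩ := BAUlt.mem_saturation.1 hgA
  have hc' := BooleanSubalgebra.closure_mono (hmono n.le_succ) hc
  have hg' := BooleanSubalgebra.subset_closure hgH
  -- The nonzero difference of `g` and `c` is generated by `H (n + 1)`, so it lies in some `p ∈ K`.
  obtain ⟨p, hp, hpH⟩ := hφp (H (n + 1)) (hκH (n + 1)) (symmDiff g c)
    (BooleanSubalgebra.sup_mem (BooleanSubalgebra.sdiff_mem hg' hc')
      (BooleanSubalgebra.sdiff_mem hc' hg'))
    (fun h => hg (symmDiff_eq_bot.1 h ▸ hc))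
  rw [← hsucc] at hpH
  exact hgc p (hpH.trans (Set.subset_iUnion H _)) hp

end Valdivia

theorem mainTheorem12 {B : Type u} [BooleanAlgebra B] [Infinite B]
    (hB : HasCountableSeparationProperty B)
    (κ : Cardinal.{u}) (hκ : κ.IsRegular) (hκ' : Cardinal.aleph0 < κ)
    (hV : IsKappaValdivia B κ) : IsKappaCorson B κ := by
  obtain ⟨G, D, hgen, hD, hGD⟩ := hV
  exact ⟨G, hgen, fun p => (mk_le_mk_of_subset Set.inter_subset_left).trans_lt
    (hB.mk_lt_of_dense hκ hκ' hgen hD hGD)⟩
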